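/- Let $K$ be a Polish space. Let $\operatorname{DSC}(K)$ be the set of all functions $f:K\to\mathbb R$ for which there is a sequence $(f_n)$ of continuous real-valued functions on $K$ with $f_n\to f$ pointwise and $\sum_{n}|f_{n+1}(k)-f_n(k)|<\infty$ for every $k\in K$. For a topological space $X$, $g:X\to[0,\infty]$ and $x\in X$, put $\varlimsup_{y\to x}g(y)=\inf_U\sup g(U)$, the infimum over all open neighborhoods $U$ of $x$ (so $y=x$ is allowed), and let $\mathbf U g(x)=\varlimsup_{y\to x}g(y)$ be the upper semi-continuous envelope of $g$. For $f:X\to\mathbb R$ the transfinite oscillations $\operatorname{osc}_\alpha f:X\to[0,\infty]$ are defined by recursion on the ordinal $\alpha$: $\operatorname{osc}_0 f\equiv 0$; for $\beta>0$, $\operatorname{osc}_\beta f=\mathbf U\,\widetilde{\operatorname{osc}}_\beta f$, where $$\widetilde{\operatorname{osc}}_{\alpha+1}f(x)=\varlimsup_{y\to x}\bigl(|f(y)-f(x)|+\operatorname{osc}_\alpha f(y)\bigr),\qquad \widetilde{\operatorname{osc}}_\beta f=\sup_{\alpha<\beta}\operatorname{osc}_\alpha f\ \text{ for limit } \beta .$$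 A point $x\in X$ is a strong continuity point of $f$ if $\operatorname{osc}_\alpha f(x)=0$ for all countable ordinals $\alpha$. **Theorem 5.1.** Let $K$ be a Polish space and $f:K\to\mathbb R$ a function. The following are equivalent: 1. $f\in\operatorname{DSC}(K)$. 2. For every non-empty closed $L\subseteq K$, the restriction $f|_L:L\to\mathbb R$ has a strong continuity point. 3. For every non-empty closed $L\subseteq K$, the set of strong continuity points of $f|_L$ contains a dense $G_\delta$ subset of $L$. 4. For every non-empty closed $L\subseteq K$ there is an $x\in L$ with $\sup_{\alpha<\omega_1}\operatorname{osc}_\alpha(f|_L)(x)<\infty$. -/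

import Mathlib

open scoped Topology ENNReal Ordinal

noncomputable section

namespace DSCTheory

/-- `DSC(K)`: the real functions on `K` that are pointwise limits of a sequence `(g n)` of
continuous real functions with `∑ |g (n+1) k - g n k| < ∞` at every point `k`. -/
def DSC (K : Type*) [TopologicalSpace K] : Set (K → ℝ) :=
  {f | ∃ g : ℕ → K → ℝ, (∀ n, Continuous (g n)) ∧
    (∀ k, Filter.Tendsto (fun n => g n k) Filter.atTop (𝓝 (f k))) ∧
    ∀ k, Summable fun n => |g (n + 1) k - g n k|}

/-- The upper semi-continuous envelope `U g (x) = inf_V sup g(V)`, where `V` runs over the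
neighbourhoods of `x` (the point `x` itself is not excluded from `V`). -/
def uscEnvelope {X : Type*} [TopologicalSpace X] (g : X → ℝ≥0∞) (x : X) : ℝ≥0∞ :=
  Filter.limsup g (𝓝 x)

/-- The `α`-th transfinite oscillation `osc_α f : X → [0, ∞]`, by ordinal recursion. -/
def osc {X : Type*} [TopologicalSpace X] (f : X → ℝ) (α : Ordinal.{0}) : X → ℝ≥0∞ :=
  Ordinal.limitRecOn (motive := fun _ => X → ℝ≥0∞) α
    (fun _ => 0)
    (fun _ oscα => uscEnvelope fun x =>
      Filter.limsup (fun y => ENNReal.ofReal |f y - f x| + oscα y) (𝓝 x))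
    (fun β _ oscLt => uscEnvelope fun x => ⨆ (α : Ordinal.{0}) (hα : α < β), oscLt α hα x)

theorem osc_zero {X : Type*} [TopologicalSpace X] (f : X → ℝ) :
    osc f 0 = fun _ => 0 := by
  simp [osc]

theorem osc_succ {X : Type*} [TopologicalSpace X] (f : X → ℝ) (α : Ordinal.{0}) :
    osc f (Order.succ α) = uscEnvelope fun x =>
      Filter.limsup (fun y => ENNReal.ofReal |f y - f x| + osc f α y) (𝓝 x) := by
  simp [osc]

theorem osc_limit {X : Type*} [TopologicalSpace X] (f : X → ℝ) (β : Ordinal.{0})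
    (hβ : Order.IsSuccLimit β) :
    osc f β = uscEnvelope fun x => ⨆ (α : Ordinal.{0}) (_ : α < β), osc f α x := by
  rw [osc, Ordinal.limitRecOn_limit _ _ _ _ hβ]
  rfl

/-- `x` is a strong continuity point of `f` if `osc_α f (x) = 0` for all countable ordinals `α`. -/
def IsStrongContinuityPoint {X : Type*} [TopologicalSpace X] (f : X → ℝ) (x : X) : Prop :=
  ∀ α : Ordinal.{0}, α < ω_ 1 → osc f α x = 0

end DSCTheory

end

/-!
Everything is read off from one notion. A function `φ` *controls* `f` on `s` if, for `y → x`
inside `s`, `|f y - f x| + φ x ≤ φ y + ε` eventually; equivalently, `φ + f` and `φ - f` are lower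
semicontinuous on `s`.

*From `DSC` to strong continuity.* If `f = lim g n` with `∑ |g (n + 1) - g n| < ∞`, this sum
controls `f`. By induction on `α`, every `φ ≥ 0` controlling `f` satisfies `osc_α f + φ ≤ U φ`,
so `osc_α f` vanishes for all `α` wherever `φ` is upper semicontinuous. In a Baire space that
happens on a dense `Gδ`, as `φ` is lower semicontinuous.

*From finite oscillation to `DSC`.* On a second countable space the oscillations stabilise at some
`α < ω₁`. Then `θ = osc_α f` satisfies `limsup_{y → x} (|f y - f x| + θ y) ≤ θ x`, which says that
`M - θ` controls `f` on the open set `{θ < M}`. Hence condition 4 gives in each non-empty closed `L`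
a non-empty relatively open piece on which `f` is bounded and has a bounded control. By the
Lindelöf property these pieces exhaust `K`: it is a countable union of closed sets `F n` of this
kind (`exists_countable_closed_cover`). Adding to the control of `F n` a constant that grows fast
enough with `n`, on `F n` minus the earlier sets, glues them to a control `φ ≥ |f|` on `K`
(`exists_lscControlOn_univ_of_closed_cover`). So `f = ((φ + f) - (φ - f)) / 2` is half a difference
of non-negative lower semicontinuous functions. These are increasing limits of continuous functions,
whose increments telescope, and `f` is in `DSC(K)` (`mem_DSC_of_lscControlOn`).
-/

namespace DSCTheory

open Filter Set

variable {X : Type*} [TopologicalSpace X]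

/-! ### Controls by semicontinuous functions -/

/-- `φ` controls `f` on `s`: both `φ + f` and `φ - f` are lower semicontinuous on `s`, written as a
single inequality on the variation of `f`. -/
def LscControlOn (f φ : X → ℝ) (s : Set X) : Prop :=
  ∀ x ∈ s, ∀ ε > 0, ∀ᶠ y in 𝓝[s] x, |f y - f x| + φ x ≤ φ y + ε

/-- `f` is bounded on `s` and has a bounded non-negative control there. One constant bounds both. -/
def HasBddLscControlOn (f : X → ℝ) (s : Set X) : Prop :=
  ∃ (φ : X → ℝ) (C : ℝ), 0 ≤ C ∧ LscControlOn f φ s ∧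
    ∀ x ∈ s, |f x| ≤ C ∧ 0 ≤ φ x ∧ φ x ≤ C

theorem LscControlOn.mono {f φ : X → ℝ} {s t : Set X} (h : LscControlOn f φ t) (hst : s ⊆ t) :
    LscControlOn f φ s :=
  fun x hx ε hε => nhdsWithin_mono x hst (h x (hst hx) ε hε)

theorem HasBddLscControlOn.mono {f : X → ℝ} {s t : Set X} (h : HasBddLscControlOn f t)
    (hst : s ⊆ t) : HasBddLscControlOn f s := by
  obtain ⟨φ, C, hC, hφ, hb⟩ := h
  exact ⟨φ, C, hC, hφ.mono hst, fun x hx => hb x (hst hx)⟩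

theorem HasBddLscControlOn.empty (f : X → ℝ) : HasBddLscControlOn f ∅ :=
  ⟨0, 0, le_rfl, fun _ hx => hx.elim, fun _ hx => hx.elim⟩

theorem LscControlOn.eventually {f φ : X → ℝ} (h : LscControlOn f φ univ) (x : X) {ε : ℝ}
    (hε : 0 < ε) : ∀ᶠ y in 𝓝 x, |f y - f x| + φ x ≤ φ y + ε := by
  simpa using h x (mem_univ x) ε hε

theorem LscControlOn.lowerSemicontinuous {f φ : X → ℝ} (h : LscControlOn f φ univ) :
    LowerSemicontinuous φ := by
  intro x c hc
  filter_upwards [h.eventually x (half_pos (sub_pos.2 hc))] with y hy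
  have := abs_nonneg (f y - f x)
  linarith

theorem LscControlOn.neg {f φ : X → ℝ} {s : Set X} (h : LscControlOn f φ s) :
    LscControlOn (-f) φ s := by
  intro x hx ε hε
  filter_upwards [h x hx ε hε] with y hy
  rwa [Pi.neg_apply, Pi.neg_apply, ← abs_neg, show -(-f y - -f x) = f y - f x by ring]

theorem LscControlOn.lowerSemicontinuous_add {f φ : X → ℝ} (h : LscControlOn f φ univ) :
    LowerSemicontinuous (φ + f) := by
  intro x c hc
  filter_upwards [h.eventually x (half_pos (sub_pos.2 hc))] with y hy
  have := neg_abs_le (f y - f x)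
  simp only [Pi.add_apply] at *
  linarith

/-- A control on a subset of the subspace `L`, extended by zero, is a control in the ambient space. -/
theorem HasBddLscControlOn.image_val {L : Set X} {f : X → ℝ} {V : Set L}
    (h : HasBddLscControlOn (L.domRestrict f) V) : HasBddLscControlOn f (Subtype.val '' V) := by
  obtain ⟨φ, C, hC, hφ, hb⟩ := h
  have hext (x : L) : Function.extend Subtype.val φ 0 (x : X) = φ x :=
    Subtype.val_injective.extend_apply φ 0 x
  refine ⟨Function.extend Subtype.val φ 0, C, hC, ?_, ?_⟩
  · rintro _ ⟨x, hx, rfl⟩ ε hε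
    rw [← Topology.IsEmbedding.subtypeVal.map_nhdsWithin_eq, eventually_map]
    filter_upwards [hφ x hx ε hε] with y hy
    simpa [hext] using hy
  · rintro _ ⟨x, hx, rfl⟩
    simpa [hext] using hb x hx

/-! ### Controls of functions in `DSC` -/

theorem DSC.domRestrict {f : X → ℝ} (hf : f ∈ DSC X) (L : Set X) : L.domRestrict f ∈ DSC L := by
  obtain ⟨g, hc, hl, hs⟩ := hf
  exact ⟨fun n => L.domRestrict (g n), fun n => (hc n).comp continuous_subtype_val,
    fun k => hl k, fun k => hs k⟩

/-- The total variation `∑ |g (n + 1) - g n|` of an approximating sequence controls the limit. -/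
theorem DSC.exists_lscControlOn {f : X → ℝ} (hf : f ∈ DSC X) :
    ∃ φ : X → ℝ, (∀ x, 0 ≤ φ x) ∧ LscControlOn f φ univ := by
  obtain ⟨g, hc, hl, hs⟩ := hf
  refine ⟨fun x => ∑' n, |g (n + 1) x - g n x|, fun x => tsum_nonneg fun n => abs_nonneg _, ?_⟩
  intro x _ ε hε
  rw [nhdsWithin_univ]
  -- The limit over `m` of the bound on the first `m` increments, with `g N` split off.
  have htail (y : X) (N : ℕ) :
      |f y - g N y| + ∑ n ∈ Finset.range N, |g (n + 1) y - g n y| ≤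
        ∑' n, |g (n + 1) y - g n y| := by
    refine le_of_tendsto (((hl y).sub_const (g N y)).abs.add_const _) ?_
    filter_upwards [eventually_ge_atTop N] with m hm
    refine le_trans ?_ ((hs y).sum_le_tsum (Finset.range m) fun n _ => abs_nonneg _)
    rw [← Finset.sum_range_add_sum_Ico _ hm, add_comm, ← Finset.sum_Ico_sub (fun n => g n y) hm]
    gcongr
    exact Finset.abs_sum_le_sum_abs _ _
  obtain ⟨N, hN⟩ := (((hs x).hasSum.tendsto_sum_nat.eventually
    (lt_mem_nhds (sub_lt_self _ (by positivity : (0 : ℝ) < ε / 4))))).exists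
  have hcont : Continuous fun y => ∑ n ∈ Finset.range N, |g (n + 1) y - g n y| :=
    continuous_finsetSum _ fun n _ => ((hc _).sub (hc _)).abs
  have h4 : (0 : ℝ) < ε / 4 := by positivity
  filter_upwards [Metric.tendsto_nhds.1 (hcont.tendsto x) _ h4,
    Metric.tendsto_nhds.1 ((hc N).tendsto x) _ h4] with y h1 h2
  rw [Real.dist_eq, abs_lt] at h1 h2
  have hx := htail x N
  have hy := htail y N
  have h3 : |f y - f x| ≤ |f y - g N y| + |f x - g N x| + ε / 4 := by
    rw [abs_le]
    constructor <;>
      linarith [neg_abs_le (f y - g N y), le_abs_self (f y - g N y), neg_abs_le (f x - g N x),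
        le_abs_self (f x - g N x)]
  linarith

/-! ### Upper semicontinuous envelopes and oscillations -/

theorem le_uscEnvelope (g : X → ℝ≥0∞) (x : X) : g x ≤ uscEnvelope g x :=
  le_of_forall_gt fun _ hc => (eventually_lt_of_limsup_lt hc).self_of_nhds

theorem upperSemicontinuous_uscEnvelope (g : X → ℝ≥0∞) :
    UpperSemicontinuous (uscEnvelope g) := by
  intro x c hc
  obtain ⟨d, hd, hdc⟩ := exists_between hc
  filter_upwards [(eventually_lt_of_limsup_lt hd).eventually_nhds] with y hy
  exact (limsup_le_of_le (h := hy.mono fun _ => le_of_lt)).trans_lt hdc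

theorem upperSemicontinuous_osc (f : X → ℝ) (α : Ordinal.{0}) :
    UpperSemicontinuous (osc f α) := by
  induction α using Ordinal.limitRecOn with
  | zero => rw [osc_zero]; exact upperSemicontinuous_const
  | add_one α _ => rw [← Order.succ_eq_add_one, osc_succ]; exact upperSemicontinuous_uscEnvelope _
  | limit α hα _ => rw [osc_limit f α hα]; exact upperSemicontinuous_uscEnvelope _

theorem limsup_le_osc_succ (f : X → ℝ) (α : Ordinal.{0}) (x : X) :
    limsup (fun y => ENNReal.ofReal |f y - f x| + osc f α y) (𝓝 x) ≤ osc f (Order.succ α) x := by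
  rw [osc_succ]
  exact le_uscEnvelope _ x

theorem osc_mono (f : X → ℝ) : Monotone (osc f) := by
  intro α β hαβ
  induction β using Ordinal.limitRecOn with
  | zero => rw [nonpos_iff_eq_zero.1 hαβ]
  | add_one β ih =>
    rw [← Order.succ_eq_add_one] at hαβ ⊢
    rcases hαβ.eq_or_lt with rfl | h
    · exact le_rfl
    · refine (ih (Order.lt_succ_iff.1 h)).trans fun x => ?_
      refine le_trans ?_ (limsup_le_osc_succ f β x)
      refine le_trans ?_ (le_uscEnvelope _ x)
      simp
  | limit β hβ _ =>
    rcases hαβ.eq_or_lt with rfl | h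
    · exact le_rfl
    · intro x
      rw [osc_limit f β hβ]
      exact le_trans (le_iSup₂ (f := fun (α : Ordinal.{0}) (_ : α < β) => osc f α x) α h)
        (le_uscEnvelope _ x)

theorem limsup_add_le {g : X → ℝ≥0∞} {x : X} {a b : ℝ≥0∞} (ha : a ≠ ∞)
    (h : ∀ᶠ y in 𝓝 x, g y + a ≤ b) : limsup g (𝓝 x) + a ≤ b := by
  have hab : a ≤ b := le_trans le_add_self h.self_of_nhds
  calc limsup g (𝓝 x) + a ≤ (b - a) + a := by
        gcongr
        exact limsup_le_of_le (h := h.mono fun y hy => ENNReal.le_sub_of_add_le_right ha hy)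
    _ = b := tsub_add_cancel_of_le hab

/-- If `Φ` is lower and `E` upper semicontinuous, the inequality `g + Φ ≤ E` passes to the envelope
of `g`. -/
theorem uscEnvelope_add_le {g Φ E : X → ℝ≥0∞} (hΦ : ∀ x, Φ x ≠ ∞) (hl : LowerSemicontinuous Φ)
    (hE : UpperSemicontinuous E) (h : ∀ x, g x + Φ x ≤ E x) (x : X) :
    uscEnvelope g x + Φ x ≤ E x := by
  refine ENNReal.le_of_forall_pos_le_add fun ε hε hEx => limsup_add_le (hΦ x) ?_
  have h2 : (ε / 2 : ℝ≥0∞) ≠ 0 := by simpa using hε.ne'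
  have hΦε : ∀ᶠ y in 𝓝 x, Φ x ≤ Φ y + ε / 2 := by
    rcases eq_or_ne (Φ x) 0 with h0 | h0
    · simp [h0]
    · filter_upwards [hl x _ (ENNReal.sub_lt_self (hΦ x) h0 h2)] with y hy
      exact tsub_le_iff_right.1 hy.le
  filter_upwards [hE x _ (ENNReal.lt_add_right hEx.ne h2), hΦε] with y h3 h4
  calc g y + Φ x ≤ g y + (Φ y + ε / 2) := by gcongr
    _ = g y + Φ y + ε / 2 := by ring
    _ ≤ E x + ε / 2 + ε / 2 := add_le_add_left ((h y).trans h3.le) _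
    _ = E x + ε := by rw [add_assoc, ENNReal.add_halves]

/-! ### Vanishing of oscillations on a dense `Gδ` -/

/-- A control `φ` bounds all transfinite oscillations at once: `osc_α f + φ ≤ U φ`. So they vanish
wherever `φ` is continuous. -/
theorem osc_add_le_uscEnvelope {f φ : X → ℝ} (hφ : ∀ x, 0 ≤ φ x) (h : LscControlOn f φ univ)
    (α : Ordinal.{0}) (x : X) :
    osc f α x + ENNReal.ofReal (φ x) ≤ uscEnvelope (fun y => ENNReal.ofReal (φ y)) x := by
  set Φ : X → ℝ≥0∞ := fun y => ENNReal.ofReal (φ y) with hΦdef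
  have hΦ (x : X) : Φ x ≠ ∞ := ENNReal.ofReal_ne_top
  have hl : LowerSemicontinuous Φ :=
    ENNReal.continuous_ofReal.comp_lowerSemicontinuous h.lowerSemicontinuous
      ENNReal.ofReal_mono
  have hE := upperSemicontinuous_uscEnvelope Φ
  change osc f α x + Φ x ≤ uscEnvelope Φ x
  induction α using Ordinal.limitRecOn generalizing x with
  | zero => simpa [osc_zero] using le_uscEnvelope Φ x
  | add_one α ih =>
    rw [← Order.succ_eq_add_one, osc_succ]
    refine uscEnvelope_add_le hΦ hl hE (fun x => ?_) x
    refine ENNReal.le_of_forall_pos_le_add fun ε hε hEx => limsup_add_le (hΦ x) ?_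
    have h2 : (0 : ℝ) < ε / 2 := by positivity
    filter_upwards [h.eventually x h2,
      hE x _ (ENNReal.lt_add_right hEx.ne (ENNReal.ofReal_pos.2 h2).ne')] with y h3 h4
    have h5 : ENNReal.ofReal |f y - f x| + Φ x ≤ Φ y + ENNReal.ofReal (ε / 2) := by
      rw [hΦdef, ← ENNReal.ofReal_add (abs_nonneg _) (hφ x), ← ENNReal.ofReal_add (hφ y) h2.le]
      exact ENNReal.ofReal_le_ofReal h3
    calc ENNReal.ofReal |f y - f x| + osc f α y + Φ x
        = (ENNReal.ofReal |f y - f x| + Φ x) + osc f α y := by ring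
      _ ≤ (Φ y + ENNReal.ofReal (ε / 2)) + osc f α y := by gcongr
      _ = (osc f α y + Φ y) + ENNReal.ofReal (ε / 2) := by ring
      _ ≤ (uscEnvelope Φ x + ENNReal.ofReal (ε / 2)) + ENNReal.ofReal (ε / 2) :=
        add_le_add_left ((ih y).trans h4.le) _
      _ = uscEnvelope Φ x + ε := by
        rw [add_assoc, ← ENNReal.ofReal_add h2.le h2.le, add_halves, ENNReal.ofReal_coe_nnreal]
  | limit β hβ ih =>
    rw [osc_limit f β hβ]
    refine uscEnvelope_add_le hΦ hl hE (fun x => ?_) x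
    rw [← ENNReal.le_sub_iff_add_le_right (hΦ x) (le_uscEnvelope Φ x)]
    exact iSup₂_le fun α hα => ENNReal.le_sub_of_add_le_right (hΦ x) (ih α hα x)

/-- A lower semicontinuous function on a Baire space is upper semicontinuous off the frontiers of
the sets `{q < φ}` with `q` rational, that is, on a dense `Gδ`. -/
theorem _root_.LowerSemicontinuous.exists_isGδ_dense_uscEnvelope_le [BaireSpace X] {φ : X → ℝ}
    (hφ : LowerSemicontinuous φ) : ∃ G : Set X, IsGδ G ∧ Dense G ∧
      ∀ x ∈ G, uscEnvelope (fun y => ENNReal.ofReal (φ y)) x ≤ ENNReal.ofReal (φ x) := by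
  have ho (q : ℚ) : IsOpen {x | (q : ℝ) < φ x} := hφ.isOpen_preimage q
  have ho' (q : ℚ) : IsOpen (frontier {x | (q : ℝ) < φ x})ᶜ := isClosed_frontier.isOpen_compl
  refine ⟨⋂ q : ℚ, (frontier {x | (q : ℝ) < φ x})ᶜ, IsGδ.iInter_of_isOpen ho',
    dense_iInter_of_isOpen ho' fun q => interior_eq_empty_iff_dense_compl.1 ?_, fun x hx => ?_⟩
  · rw [← frontier_compl]
    exact interior_frontier (ho q).isClosed_compl
  refine ENNReal.le_of_forall_pos_le_add fun ε hε _ => ?_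
  obtain ⟨q, hq, hqε⟩ := exists_rat_btwn (lt_add_of_pos_right (φ x) (NNReal.coe_pos.2 hε))
  have hxq : x ∈ (frontier {x | (q : ℝ) < φ x})ᶜ := mem_iInter.1 hx q
  have hcl : x ∉ closure {x | (q : ℝ) < φ x} := fun hxc =>
    hxq ⟨hxc, by rw [(ho q).interior_eq]; exact not_lt.2 hq.le⟩
  refine limsup_le_of_le (h := ?_)
  filter_upwards [isClosed_closure.isOpen_compl.mem_nhds hcl] with y hy
  have hyq : φ y ≤ q := not_lt.1 fun h => hy (subset_closure h)
  calc ENNReal.ofReal (φ y) ≤ ENNReal.ofReal (φ x + ε) :=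
        ENNReal.ofReal_le_ofReal (hyq.trans hqε.le)
    _ ≤ ENNReal.ofReal (φ x) + ENNReal.ofReal ε := ENNReal.ofReal_add_le
    _ = ENNReal.ofReal (φ x) + ε := by rw [ENNReal.ofReal_coe_nnreal]

theorem DSC.exists_isGδ_dense_isStrongContinuityPoint [BaireSpace X] {f : X → ℝ}
    (hf : f ∈ DSC X) :
    ∃ G : Set X, IsGδ G ∧ Dense G ∧ ∀ x ∈ G, IsStrongContinuityPoint f x := by
  obtain ⟨φ, hφ, h⟩ := DSC.exists_lscControlOn hf
  obtain ⟨G, hG, hd, hle⟩ := h.lowerSemicontinuous.exists_isGδ_dense_uscEnvelope_le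
  refine ⟨G, hG, hd, fun x hx α _ => ?_⟩
  have := (osc_add_le_uscEnvelope hφ h α x).trans (hle x hx)
  simpa using ENNReal.le_sub_of_add_le_right ENNReal.ofReal_ne_top this

/-! ### Stabilisation of the oscillations -/

/-- Monotone functions `ω₁ → [0, ∞]` are eventually constant, because a supremum in `[0, ∞]` is the
limit of a sequence and `ω₁` has uncountable cofinality. -/
theorem exists_lt_omega_one_forall_le {h : Ordinal.{0} → ℝ≥0∞} (hm : Monotone h) :
    ∃ α < ω_ 1, ∀ β < ω_ 1, h β ≤ h α := by
  have hne : (h '' Iio (ω_ 1)).Nonempty :=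
    ⟨h 0, 0, lt_of_lt_of_le Ordinal.omega0_pos Ordinal.omega0_lt_omega_one.le, rfl⟩
  obtain ⟨u, -, hu, hmem⟩ := exists_seq_tendsto_sSup hne (OrderTop.bddAbove _)
  choose a ha hau using hmem
  refine ⟨⨆ n, a n, Ordinal.iSup_lt_omega_one ha, fun β hβ => ?_⟩
  refine (le_sSup (mem_image_of_mem h hβ)).trans (le_of_tendsto' hu fun n => ?_)
  rw [← hau]
  exact hm (Ordinal.le_iSup a n)

/-- The oscillations stabilise at a countable ordinal: being upper semicontinuous, they are determined
by their suprema over the members of a countable basis, each of which stabilises. -/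
theorem exists_osc_succ_le [SecondCountableTopology X] (f : X → ℝ) :
    ∃ α < ω_ 1, osc f (Order.succ α) ≤ osc f α := by
  have hm (V : Set X) : Monotone fun α => ⨆ y ∈ V, osc f α y :=
    fun α β hαβ => iSup₂_mono fun y _ => osc_mono f hαβ y
  choose a ha hle using fun V => exists_lt_omega_one_forall_le (hm V)
  have hB := TopologicalSpace.countable_countableBasis X
  have := hB.to_subtype
  have hγ : (⨆ V : TopologicalSpace.countableBasis X, a V) < ω_ 1 :=
    Ordinal.iSup_lt_omega_one fun V => ha V
  refine ⟨_, hγ, fun x => le_of_forall_gt_imp_ge_of_dense fun c hc => ?_⟩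
  -- Past `γ` the supremum over every basic open set is constant.
  set γ := ⨆ V : TopologicalSpace.countableBasis X, a V with hγdef
  obtain ⟨V, hV, hxV, hVc⟩ := (TopologicalSpace.isBasis_countableBasis X).mem_nhds_iff.1
    (upperSemicontinuous_osc f γ x c hc)
  have hsucc : Order.succ γ < ω_ 1 := (Cardinal.isSuccLimit_omega 1).succ_lt hγ
  calc osc f (Order.succ γ) x ≤ ⨆ y ∈ V, osc f (Order.succ γ) y :=
        le_iSup₂ (f := fun y (_ : y ∈ V) => osc f (Order.succ γ) y) x hxV
    _ ≤ ⨆ y ∈ V, osc f (a V) y := hle V _ hsucc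
    _ ≤ ⨆ y ∈ V, osc f γ y :=
        hm V (Ordinal.le_iSup (fun V : TopologicalSpace.countableBasis X => a V) ⟨V, hV⟩)
    _ ≤ c := iSup₂_le fun y hy => (hVc hy).le

/-- If `θ` is the stabilised oscillation, then `M - θ` controls `f` near each point where `θ` is finite. -/
theorem exists_isOpen_hasBddLscControlOn [SecondCountableTopology X] {f : X → ℝ} {x₀ : X}
    (hx₀ : (⨆ (α : Ordinal.{0}) (_ : α < ω_ 1), osc f α x₀) < ∞) :
    ∃ V : Set X, IsOpen V ∧ x₀ ∈ V ∧ HasBddLscControlOn f V := by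
  obtain ⟨α, hα, hle⟩ := exists_osc_succ_le f
  set θ := osc f α with hθ
  have hfin : θ x₀ < ∞ :=
    (le_iSup₂ (f := fun (α : Ordinal.{0}) (_ : α < ω_ 1) => osc f α x₀) α hα).trans_lt hx₀
  have key (x : X) : limsup (fun y => ENNReal.ofReal |f y - f x| + θ y) (𝓝 x) ≤ θ x :=
    (limsup_le_osc_succ f α x).trans (hle x)
  have husc : UpperSemicontinuous θ := upperSemicontinuous_osc f α
  set M : ℝ := (θ x₀).toReal + 1 with hM
  have hM0 : 0 ≤ M := by positivity
  have hMx₀ : θ x₀ < ENNReal.ofReal M := by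
    rw [ENNReal.lt_ofReal_iff_toReal_lt hfin.ne]
    exact lt_add_one _
  have hctrl : LscControlOn f (fun y => M - (θ y).toReal) {x | θ x < ENNReal.ofReal M} := by
    intro x hx ε hε
    have hx' : θ x ≠ ∞ := (lt_top_of_lt hx).ne
    refine mem_nhdsWithin_of_mem_nhds ?_
    filter_upwards [eventually_lt_of_limsup_lt ((key x).trans_lt
      (ENNReal.lt_add_right hx' (ENNReal.ofReal_pos.2 hε).ne'))] with y hy
    have hy' : θ y ≠ ∞ := (le_add_self.trans_lt (lt_top_of_lt hy)).ne
    rw [← ENNReal.ofReal_toReal hx', ← ENNReal.ofReal_toReal hy',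
      ← ENNReal.ofReal_add (abs_nonneg _) ENNReal.toReal_nonneg,
      ← ENNReal.ofReal_add ENNReal.toReal_nonneg hε.le,
      ENNReal.ofReal_lt_ofReal_iff (by positivity)] at hy
    linarith
  have hbdd : ∀ x, θ x < ENNReal.ofReal M → 0 ≤ M - (θ x).toReal ∧ M - (θ x).toReal ≤ M := by
    intro x hx
    rw [ENNReal.lt_ofReal_iff_toReal_lt (lt_top_of_lt hx).ne] at hx
    exact ⟨by linarith, by linarith [ENNReal.toReal_nonneg (a := θ x)]⟩
  have hopen : IsOpen {x | θ x < ENNReal.ofReal M} := husc.isOpen_preimage _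
  -- Near `x₀`, the control inequality itself bounds `f`.
  have hnear : ∀ᶠ y in 𝓝 x₀, |f y - f x₀| + (M - (θ x₀).toReal) ≤ M - (θ y).toReal + 1 := by
    have := hctrl x₀ hMx₀ 1 one_pos
    rwa [hopen.nhdsWithin_eq hMx₀] at this
  obtain ⟨W, hW, hWo, hxW⟩ := mem_nhds_iff.1 hnear
  refine ⟨{x | θ x < ENNReal.ofReal M} ∩ W, hopen.inter hWo, ⟨hMx₀, hxW⟩, _,
    |f x₀| + M + 1, by positivity, hctrl.mono inter_subset_left, ?_⟩
  rintro x ⟨hx, hxW⟩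
  have h1 := hbdd x hx
  have h2 := hbdd x₀ hMx₀
  have h3 : |f x - f x₀| + (M - (θ x₀).toReal) ≤ M - (θ x).toReal + 1 := hW hxW
  have h4 : |f x| ≤ |f x - f x₀| + |f x₀| := by simpa using abs_add_le (f x - f x₀) (f x₀)
  exact ⟨by linarith, h1.1, by linarith [abs_nonneg (f x₀)]⟩

/-! ### Covering by closed sets with a bounded control -/

/-- Lindelöf argument: let `S` be the family of open sets covered by countably many closed sets with
a bounded control. If `⋃₀ S` were not everything, the hypothesis for its complement would produce
a new member of `S`. -/
theorem exists_countable_closed_cover [PolishSpace X] {f : X → ℝ}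
    (h : ∀ L : Set X, IsClosed L → L.Nonempty → ∃ x : L,
      (⨆ (α : Ordinal.{0}) (_ : α < ω_ 1), osc (L.domRestrict f) α x) < ∞) :
    ∃ F : ℕ → Set X, (∀ n, IsClosed (F n) ∧ HasBddLscControlOn f (F n)) ∧ ⋃ n, F n = univ := by
  let _ := TopologicalSpace.upgradeIsCompletelyMetrizable X
  set S : Set (Set X) := {U | IsOpen U ∧ ∃ c : Set (Set X), c.Countable ∧
    (∀ F ∈ c, IsClosed F ∧ HasBddLscControlOn f F) ∧ U ⊆ ⋃₀ c} with hS
  obtain ⟨T, hTc, hTS, hTu⟩ := TopologicalSpace.isOpen_sUnion_countable S fun U hU => hU.1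
  choose! c hcc hcF hcU using fun U (hU : U ∈ S) => hU.2
  have hbcc : (⋃ U ∈ T, c U).Countable := hTc.biUnion fun U hU => hcc U (hTS hU)
  have hbcF : ∀ F ∈ ⋃ U ∈ T, c U, IsClosed F ∧ HasBddLscControlOn f F := by
    intro F hF
    obtain ⟨U, hU, hFU⟩ := mem_iUnion₂.1 hF
    exact hcF U (hTS hU) F hFU
  have hbcU : ⋃₀ S ⊆ ⋃₀ (⋃ U ∈ T, c U) := by
    rw [← hTu]
    rintro x ⟨U, hU, hxU⟩
    obtain ⟨F, hF, hxF⟩ := hcU U (hTS hU) hxU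
    exact ⟨F, mem_iUnion₂.2 ⟨U, hU, hF⟩, hxF⟩
  have hSo : IsOpen (⋃₀ S) := isOpen_sUnion fun U hU => hU.1
  have huniv : ⋃₀ S = univ := by
    by_contra hne
    obtain ⟨x, hx⟩ := h (⋃₀ S)ᶜ hSo.isClosed_compl (nonempty_compl.2 hne)
    obtain ⟨V, hV, hxV, hVf⟩ := exists_isOpen_hasBddLscControlOn hx
    obtain ⟨O, hO, rfl⟩ := isOpen_induced_iff.1 hV
    obtain ⟨C, hC, -, hCO, -⟩ := hO.exists_iUnion_isClosed
    have hVf' := hVf.image_val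
    rw [Subtype.image_preimage_coe] at hVf'
    -- The part of `O` outside `⋃₀ S` has a bounded control; intersecting with closed sets exhausting
    -- `O` makes the pieces closed.
    have hOS : O ∈ S := by
      refine ⟨hO, (⋃ U ∈ T, c U) ∪ range fun n => (⋃₀ S)ᶜ ∩ C n,
        hbcc.union (countable_range _), ?_, fun y hy => ?_⟩
      · rintro F (hF | ⟨n, rfl⟩)
        · exact hbcF F hF
        · exact ⟨hSo.isClosed_compl.inter (hC n),
            hVf'.mono (inter_subset_inter_right _ (hCO ▸ subset_iUnion C n))⟩
      · by_cases hyS : y ∈ ⋃₀ S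
        · obtain ⟨F, hF, hyF⟩ := hbcU hyS
          exact ⟨F, Or.inl hF, hyF⟩
        · rw [← hCO] at hy
          obtain ⟨n, hn⟩ := mem_iUnion.1 hy
          exact ⟨_, Or.inr ⟨n, rfl⟩, hyS, hn⟩
    exact x.2 ⟨O, hOS, hxV⟩
  obtain ⟨F, hF⟩ := (hbcc.insert ∅).exists_eq_range (insert_nonempty _ _)
  refine ⟨F, fun n => ?_, ?_⟩
  · rcases (hF ▸ mem_range_self n : F n ∈ insert ∅ (⋃ U ∈ T, c U)) with h0 | h0
    · rw [h0]
      exact ⟨isClosed_empty, HasBddLscControlOn.empty f⟩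
    · exact hbcF _ h0
  · rw [← sUnion_range, ← hF, sUnion_insert, empty_union]
    exact univ_subset_iff.1 (huniv ▸ hbcU)

/-! ### Gluing of controls -/

/-- Gluing of bounded controls along a countable closed cover. Points near `x` avoid the closed sets
that precede the first one containing `x`, so only jumps to later sets have to be paid for. -/
theorem exists_lscControlOn_univ_of_closed_cover {f : X → ℝ} {F : ℕ → Set X}
    (hF : ∀ n, IsClosed (F n) ∧ HasBddLscControlOn f (F n)) (hU : ⋃ n, F n = univ) :
    ∃ φ : X → ℝ, (∀ x, |f x| ≤ φ x) ∧ LscControlOn f φ univ := by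
  classical
  choose hcl φ C hC hφ hb using hF
  have hex (x : X) : ∃ n, x ∈ F n := mem_iUnion.1 (hU ▸ mem_univ x)
  -- `m x` is the index of the first closed set containing `x`.
  set m : X → ℕ := fun x => Nat.find (hex x) with hm
  have hmem (x : X) : x ∈ F (m x) := Nat.find_spec (hex x)
  set D : ℕ → ℝ := fun n => ∑ k ∈ Finset.range (n + 1), C k with hD
  have hCD {k n : ℕ} (hkn : k ≤ n) : C k ≤ D n :=
    Finset.single_le_sum (fun k _ => hC k) (Finset.mem_range_succ_iff.2 hkn)
  have hD0 (n : ℕ) : 0 ≤ D n := Finset.sum_nonneg fun k _ => hC k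
  -- A jump from `F k` to a later `F n` costs at most `|f x| + |f y| + φ k x ≤ 2 * C k + C n`, which
  -- is at most `3 * D n`.
  set B : ℕ → ℝ := fun n => 3 * ∑ k ∈ Finset.range (n + 1), D k with hB
  have hBsucc (n : ℕ) : B (n + 1) = B n + 3 * D (n + 1) := by
    simp only [hB]
    rw [Finset.sum_range_succ _ (n + 1)]
    ring
  have hBmono : Monotone B := monotone_nat_of_le_succ fun n => by linarith [hBsucc n, hD0 (n + 1)]
  have hDB (n : ℕ) : 3 * D n ≤ B n :=
    mul_le_mul_of_nonneg_left (Finset.single_le_sum (fun k _ => hD0 k)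
      (Finset.self_mem_range_succ n)) zero_le_three
  have hBlt {k n : ℕ} (hkn : k < n) : B k + 3 * D n ≤ B n := by
    obtain ⟨n, rfl⟩ := Nat.exists_eq_succ_of_ne_zero (Nat.ne_zero_of_lt hkn)
    linarith [hBsucc n, hBmono (Nat.lt_succ_iff.1 hkn)]
  refine ⟨fun x => φ (m x) x + B (m x), fun x => ?_, ?_⟩
  · have := hb _ x (hmem x)
    linarith [hDB (m x), hCD (le_refl (m x)), hD0 (m x)]
  · intro x _ ε hε
    rw [nhdsWithin_univ]
    have h1 : ∀ᶠ y in 𝓝 x, ∀ k ∈ Finset.range (m x), y ∉ F k := by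
      rw [Filter.eventually_all_finset]
      intro k hk
      exact (hcl k).isOpen_compl.mem_nhds (Nat.find_min (hex x) (Finset.mem_range.1 hk))
    filter_upwards [h1, eventually_nhdsWithin_iff.1 (hφ (m x) x (hmem x) ε hε)] with y hy1 hy2
    have hle : m x ≤ m y := by
      by_contra! hlt
      exact hy1 _ (Finset.mem_range.2 hlt) (hmem y)
    rcases hle.eq_or_lt with heq | hlt
    · have := hy2 (heq ▸ hmem y)
      rw [← heq]
      linarith
    · have hx := hb _ x (hmem x)
      have hy := hb _ y (hmem y)
      have h3 : |f y - f x| ≤ |f y| + |f x| := abs_sub _ _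
      linarith [hBlt hlt, hCD hlt.le, hCD (le_refl (m y))]

/-! ### Approximation of semicontinuous functions by continuous ones -/

/-- Approximation from below by the inf-convolutions `x ↦ inf_y (u y + n * dist x y)`. -/
theorem _root_.LowerSemicontinuous.exists_monotone_continuous_tendsto {X : Type*}
    [PseudoMetricSpace X] {u : X → ℝ} (hu : LowerSemicontinuous u) (h0 : ∀ x, 0 ≤ u x) :
    ∃ U : ℕ → X → ℝ, (∀ n, Continuous (U n)) ∧ Monotone U ∧
      ∀ x, Tendsto (fun n => U n x) atTop (𝓝 (u x)) := by
  have hterm (n : ℕ) (x y : X) : 0 ≤ u y + n * dist x y := by have := h0 y; positivity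
  have hbdd (n : ℕ) (x : X) : BddBelow (range fun y => u y + n * dist x y) :=
    ⟨0, by rintro _ ⟨y, rfl⟩; exact hterm n x y⟩
  have hle (n : ℕ) (x : X) : ⨅ y, (u y + n * dist x y) ≤ u x := by
    simpa using ciInf_le (hbdd n x) x
  have hmono : Monotone fun (n : ℕ) (x : X) => ⨅ y, (u y + n * dist x y) := by
    intro n n' hn x
    exact ciInf_mono (hbdd n x) fun y => by gcongr
  refine ⟨fun n x => ⨅ y, (u y + n * dist x y), fun n => ?_, hmono, fun x => ?_⟩
  · refine (LipschitzWith.of_le_add_mul n fun x x' => ?_).continuous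
    have : Nonempty X := ⟨x⟩
    rw [← sub_le_iff_le_add]
    refine le_ciInf fun y => ?_
    have h1 := ciInf_le (hbdd n x) y
    have h2 := mul_le_mul_of_nonneg_left (dist_triangle x x' y) (Nat.cast_nonneg (α := ℝ) n)
    simp only [NNReal.coe_natCast]
    linarith
  · have : Nonempty X := ⟨x⟩
    refine tendsto_order.2 ⟨fun a ha => ?_, fun a ha => Eventually.of_forall fun n =>
      (hle n x).trans_lt ha⟩
    obtain ⟨b, hab, hb⟩ := exists_between ha
    obtain ⟨δ, hδ, hball⟩ := Metric.eventually_nhds_iff.1 (hu x b hb)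
    obtain ⟨N, hN⟩ := exists_nat_gt (u x / δ)
    filter_upwards [eventually_ge_atTop N] with n hn
    refine hab.trans_le (le_ciInf fun y => ?_)
    rcases lt_or_ge (dist x y) δ with hd | hd
    · have h1 := hball (y := y) (by rwa [dist_comm])
      have h2 : 0 ≤ n * dist x y := by positivity
      linarith
    · have h1 : u x < N * δ := (div_lt_iff₀ hδ).1 hN
      have h2 : (N : ℝ) * δ ≤ n * dist x y := by gcongr
      linarith [h0 y]

/-- The condition `|f| ≤ φ` makes the lower semicontinuous functions `φ + f` and `φ - f` non-negative,
hence limits of increasing sequences of continuous functions. -/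
theorem mem_DSC_of_lscControlOn [TopologicalSpace.PseudoMetrizableSpace X] {f φ : X → ℝ}
    (hfφ : ∀ x, |f x| ≤ φ x) (h : LscControlOn f φ univ) : f ∈ DSC X := by
  let _ := TopologicalSpace.pseudoMetrizableSpacePseudoMetric X
  obtain ⟨U, hUc, hUm, hUt⟩ := h.lowerSemicontinuous_add.exists_monotone_continuous_tendsto
    fun x => by simp only [Pi.add_apply]; linarith [neg_abs_le (f x), hfφ x]
  obtain ⟨V, hVc, hVm, hVt⟩ := h.neg.lowerSemicontinuous_add.exists_monotone_continuous_tendsto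
    fun x => by simp only [Pi.add_apply, Pi.neg_apply]; linarith [le_abs_self (f x), hfφ x]
  have hsum {W : ℕ → X → ℝ} {w : X → ℝ} (hm : Monotone W)
      (ht : ∀ x, Tendsto (fun n => W n x) atTop (𝓝 (w x))) (x : X) :
      Summable fun n => W (n + 1) x - W n x := by
    refine summable_of_sum_range_le (c := w x - W 0 x)
      (fun n => sub_nonneg.2 (hm n.le_succ x)) fun n => ?_
    rw [Finset.sum_range_sub (fun n => W n x)]
    have : Monotone fun n => W n x := fun i j hij => hm hij x
    linarith [this.ge_of_tendsto (ht x) n]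
  refine ⟨fun n x => (U n x - V n x) / 2, fun n => ((hUc n).sub (hVc n)).div_const 2, fun x => ?_,
    fun x => ?_⟩
  · have := ((hUt x).sub (hVt x)).div_const 2
    simp only [Pi.add_apply, Pi.neg_apply] at this
    convert this using 2
    ring
  · refine Summable.of_nonneg_of_le (fun n => abs_nonneg _) (fun n => ?_)
      ((hsum hUm hUt x).add (hsum hVm hVt x))
    have hU := hUm n.le_succ x
    have hV := hVm n.le_succ x
    simp only [Nat.succ_eq_add_one] at hU hV
    rw [abs_le]
    constructor <;> linarith

end DSCTheory

/-! ### The characterization of `DSC` -/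

theorem theorem5p1 {K : Type*} [TopologicalSpace K] [PolishSpace K] (f : K → ℝ) :
    List.TFAE [
      f ∈ DSCTheory.DSC K,
      ∀ L : Set K, IsClosed L → L.Nonempty →
        ∃ x : L, DSCTheory.IsStrongContinuityPoint (L.domRestrict f) x,
      ∀ L : Set K, IsClosed L → L.Nonempty →
        ∃ G : Set L, IsGδ G ∧ Dense G ∧
          ∀ x ∈ G, DSCTheory.IsStrongContinuityPoint (L.domRestrict f) x,
      ∀ L : Set K, IsClosed L → L.Nonempty →
        ∃ x : L, (⨆ (α : Ordinal.{0}) (_ : α < ω_ 1), DSCTheory.osc (L.domRestrict f) α x) < ∞] := by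
  tfae_have 1 → 3 := by
    intro hf L hL _
    have := hL.polishSpace
    let _ := TopologicalSpace.upgradeIsCompletelyMetrizable L
    exact DSCTheory.DSC.exists_isGδ_dense_isStrongContinuityPoint
      (DSCTheory.DSC.domRestrict hf L)
  tfae_have 3 → 2 := by
    intro h L hL hne
    have := hne.to_subtype
    obtain ⟨G, -, hd, hG⟩ := h L hL hne
    obtain ⟨x, hx⟩ := hd.nonempty
    exact ⟨x, hG x hx⟩
  tfae_have 2 → 4 := by
    intro h L hL hne
    obtain ⟨x, hx⟩ := h L hL hne
    refine ⟨x, lt_of_le_of_lt (iSup₂_le fun α hα => (hx α hα).le) ENNReal.zero_lt_top⟩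
  tfae_have 4 → 1 := by
    intro h
    obtain ⟨F, hF, hU⟩ := DSCTheory.exists_countable_closed_cover h
    obtain ⟨φ, hfφ, hφ⟩ := DSCTheory.exists_lscControlOn_univ_of_closed_cover hF hU
    exact DSCTheory.mem_DSC_of_lscControlOn hfφ hφ
  tfae_finish
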